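/- Let $n\ge 1$ and let $f\in C^\infty(\mathbb{R}^n)$ be a convex real-valued function with $\lim_{|x|\to\infty} f(x)/|x| = +\infty$. For $\lambda\in\mathbb{R}$ consider the equation $$\max\{\lambda-\Delta u-f,\ |Du|-1\}=0\quad\text{on }\mathbb{R}^n.\qquad(E_\lambda)$$ An upper semicontinuous function $u:\mathbb{R}^n\to\mathbb{R}$ is a (viscosity) subsolution of $(E_\lambda)$ if for every $x_0\in\mathbb{R}^n$ and every $\varphi\in C^2(\mathbb{R}^n)$ such that $u-\varphi$ has a local maximum at $x_0$, $$\max\{\lambda-\Delta\varphi(x_0)-f(x_0),\ |D\varphi(x_0)|-1\}\le 0.$$ A lower semicontinuous function $v:\mathbb{R}^n\to\mathbb{R}$ is a (viscosity) supersolution of $(E_\lambda)$ if for every $y_0\in\mathbb{R}^n$ and every $\psi\in C^2(\mathbb{R}^n)$ such that $v-\psi$ has a local minimum at $y_0$, $$\max\{\lambda-\Delta\psi(y_0)-f(y_0),\ |D\psi(y_0)|-1\}\ge 0.$$ A viscosity solution is a continuous function that is both a subsolution and a supersolution. Suppose that $\lambda^*\in\mathbb{R}$ is such that $(E_{\lambda^*})$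 has a viscosity solution $u$ with $\lim_{|x|\to\infty}u(x)/|x|=1$. Then $$\lambda^*=\sup\Big\{\lambda\in\mathbb{R}:\ (E_\lambda)\text{ has a subsolution }u\text{ with }\limsup_{|x|\to\infty}\frac{u(x)}{|x|}\le 1\Big\}$$ and $$\lambda^*=\inf\Big\{\mu\in\mathbb{R}:\ (E_\mu)\text{ has a supersolution }v\text{ with }\liminf_{|x|\to\infty}\frac{v(x)}{|x|}\ge 1\Big\},$$ where the limits superior and inferior are taken in $[-\infty,+\infty]$. -/

import Mathlib

open Set Filter Topology
open scoped ContDiff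

/-- `u` is a viscosity subsolution on `ℝⁿ` of `max {lam - Δu - f, |Du| - 1} = 0`
with eigenvalue `lam`: it is upper semicontinuous and the inequality `≤ 0` holds for every `C²` test
function `φ` at every local maximum of `u - φ`. -/
def IsViscositySubsolution {n : ℕ} (f : EuclideanSpace ℝ (Fin n) → ℝ) (lam : ℝ)
    (u : EuclideanSpace ℝ (Fin n) → ℝ) : Prop :=
  UpperSemicontinuous u ∧
    ∀ (x₀ : EuclideanSpace ℝ (Fin n)) (φ : EuclideanSpace ℝ (Fin n) → ℝ),
      ContDiff ℝ 2 φ → IsLocalMax (fun x => u x - φ x) x₀ →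
        max (lam - Laplacian.laplacian φ x₀ - f x₀) (‖gradient φ x₀‖ - 1) ≤ 0

/-- `v` is a viscosity supersolution on `ℝⁿ` of `max {mu - Δv - f, |Dv| - 1} = 0`
with eigenvalue `mu`: it is lower semicontinuous and the inequality `≥ 0` holds for every `C²` test
function `ψ` at every local minimum of `v - ψ`. -/
def IsViscositySupersolution {n : ℕ} (f : EuclideanSpace ℝ (Fin n) → ℝ) (mu : ℝ)
    (v : EuclideanSpace ℝ (Fin n) → ℝ) : Prop :=
  LowerSemicontinuous v ∧
    ∀ (y₀ : EuclideanSpace ℝ (Fin n)) (ψ : EuclideanSpace ℝ (Fin n) → ℝ),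
      ContDiff ℝ 2 ψ → IsLocalMin (fun x => v x - ψ x) y₀ →
        0 ≤ max (mu - Laplacian.laplacian ψ y₀ - f y₀) (‖gradient ψ y₀‖ - 1)

/-- `u` is a (continuous) viscosity solution on `ℝⁿ` of `max {lam - Δu - f, |Du| - 1} = 0`
with eigenvalue `lam`. -/
def IsViscositySolution {n : ℕ} (f : EuclideanSpace ℝ (Fin n) → ℝ) (lam : ℝ)
    (u : EuclideanSpace ℝ (Fin n) → ℝ) : Prop :=
  Continuous u ∧ IsViscositySubsolution f lam u ∧ IsViscositySupersolution f lam u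

/-- `limsup_{|x| → ∞} u(x) / |x|`, as an extended real number. -/
noncomputable def limsupGrowth {n : ℕ} (u : EuclideanSpace ℝ (Fin n) → ℝ) : EReal :=
  limsup (fun x => ((u x / ‖x‖ : ℝ) : EReal)) (Bornology.cobounded (EuclideanSpace ℝ (Fin n)))

/-- `liminf_{|x| → ∞} v(x) / |x|`, as an extended real number. -/
noncomputable def liminfGrowth {n : ℕ} (v : EuclideanSpace ℝ (Fin n) → ℝ) : EReal :=
  liminf (fun x => ((v x / ‖x‖ : ℝ) : EReal)) (Bornology.cobounded (EuclideanSpace ℝ (Fin n)))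

/-! Both sets contain `lamStar`, because a solution with `u(x)/|x| → 1` is admissible on either side.
So the claim is the comparison principle: if `u` is a subsolution for `lam` with growth at most
`|x|` and `v` is a supersolution for `mu` with growth at least `|x|`, then `lam ≤ mu`
(`le_of_subsolution_of_supersolution`).

The equation says that a subsolution satisfies two separate conditions, `|Du| ≤ 1` and
`Δu ≥ lam - f`. The first makes `u` Lipschitz with constant one
(`IsViscositySubsolution.lipschitzWith`), and the second is linear. Both therefore survive
mollification (`lipschitzWith_mollify`, `le_laplacian_mollify`), and a mollification `U` of `u` is a
smooth function with `|DU| ≤ 1` and `ΔU ≥ lam - f - η` on any given ball. For `0 < τ < 1` the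
function `v - τ U` tends to infinity, and `τ U` is a test function for `v` at its minimum point `m`.
As `|D(τ U)| ≤ τ < 1` there, the second-order part of the supersolution condition holds, and
`mu - f m ≥ τ ΔU(m) ≥ τ (lam - f m - η)`. Hence `mu - τ lam ≥ (1 - τ) inf f - τ η`, and it remains
to let `η → 0` and `τ → 1`. Here `inf f` is finite because of the growth of `f`.

The linear fact behind this is the sub-mean value inequality for viscosity inequalities `Δw ≥ c`
(`ViscosityLaplacianGE.le_harmonicMean`). It follows by comparing `w` on a ball with the solution of
a Dirichlet problem. Polynomial boundary data have polynomial solutions, by linear algebra and the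
maximum principle (`exists_harmonic_polynomial_eq_on_sphere`), and polynomials are dense in the
continuous functions on the sphere. The spherical mean is replaced by a Hahn–Banach extension of
the functional `H ↦ H(0)` on harmonic polynomials (`exists_isHarmonicMean`), so that no surface
measure appears. -/

/-! ### Polynomial functions and their Laplacian -/

/-- The function on Euclidean space defined by a polynomial in the coordinates. -/
noncomputable def polyFun {n : ℕ} (p : MvPolynomial (Fin n) ℝ) (x : EuclideanSpace ℝ (Fin n)) : ℝ :=
  MvPolynomial.eval x.ofLp p

/-- The algebraic Laplacian `∑ᵢ ∂ᵢ²` on polynomials. -/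
noncomputable def polyLaplacian (n : ℕ) : MvPolynomial (Fin n) ℝ →ₗ[ℝ] MvPolynomial (Fin n) ℝ :=
  ∑ i, (MvPolynomial.pderiv i).toLinearMap ∘ₗ (MvPolynomial.pderiv i).toLinearMap

/-- The polynomial `∑ᵢ Xᵢ²`, whose value at `x` is `‖x‖²`. -/
noncomputable def normSqPoly (n : ℕ) : MvPolynomial (Fin n) ℝ := ∑ i, MvPolynomial.X i ^ 2

lemma polyFun_C {n : ℕ} (a : ℝ) :
    (polyFun (MvPolynomial.C a) : EuclideanSpace ℝ (Fin n) → ℝ) = fun _ => a := by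
  ext; simp [polyFun]

lemma polyFun_add {n : ℕ} (p q : MvPolynomial (Fin n) ℝ) :
    polyFun (p + q) = fun x => polyFun p x + polyFun q x := by
  ext; simp [polyFun]

lemma polyFun_mul_X {n : ℕ} (p : MvPolynomial (Fin n) ℝ) (j : Fin n) :
    polyFun (p * MvPolynomial.X j) = fun x => polyFun p x * x j := by
  ext; simp [polyFun]

lemma polyLaplacian_apply {n : ℕ} (p : MvPolynomial (Fin n) ℝ) :
    polyLaplacian n p = ∑ i, MvPolynomial.pderiv i (MvPolynomial.pderiv i p) := by
  simp [polyLaplacian]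

lemma hasFDerivAt_polyFun {n : ℕ} (p : MvPolynomial (Fin n) ℝ) (x : EuclideanSpace ℝ (Fin n)) :
    HasFDerivAt (polyFun p) (∑ i, polyFun (MvPolynomial.pderiv i p) x •
      (EuclideanSpace.proj i : EuclideanSpace ℝ (Fin n) →L[ℝ] ℝ)) x := by
  induction p using MvPolynomial.induction_on with
  | C a =>
    rw [polyFun_C]
    simpa [polyFun] using hasFDerivAt_const a x
  | add p q hp hq =>
    rw [polyFun_add]
    convert! hp.add hq using 1
    simp [polyFun, add_smul, Finset.sum_add_distrib]
  | mul_X p j hp =>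
    have h1 : HasFDerivAt (fun y : EuclideanSpace ℝ (Fin n) => y j)
        (EuclideanSpace.proj j : EuclideanSpace ℝ (Fin n) →L[ℝ] ℝ) x :=
      (EuclideanSpace.proj j : EuclideanSpace ℝ (Fin n) →L[ℝ] ℝ).hasFDerivAt
    rw [polyFun_mul_X]
    convert! hp.mul h1 using 1
    simp only [polyFun, MvPolynomial.pderiv_mul, map_add, map_mul,
      MvPolynomial.eval_X, add_smul, Finset.sum_add_distrib, Finset.smul_sum, smul_smul]
    rw [add_comm]
    congr 1
    · rw [Finset.sum_eq_single j] <;> simp +contextual [Ne.symm]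
    · exact Finset.sum_congr rfl fun i _ => by rw [mul_comm]

lemma contDiff_polyFun {n : ℕ} (p : MvPolynomial (Fin n) ℝ) {k : WithTop ℕ∞} :
    ContDiff ℝ k (polyFun p) := by
  induction p using MvPolynomial.induction_on with
  | C a => rw [polyFun_C]; exact contDiff_const
  | add p q hp hq => rw [polyFun_add]; exact hp.add hq
  | mul_X p j hp =>
    have h1 : ContDiff ℝ k (fun y : EuclideanSpace ℝ (Fin n) => y j) :=
      (EuclideanSpace.proj j : EuclideanSpace ℝ (Fin n) →L[ℝ] ℝ).contDiff
    rw [polyFun_mul_X]; exact hp.mul h1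

lemma laplacian_eq_sum {n : ℕ} (h : EuclideanSpace ℝ (Fin n) → ℝ) (x : EuclideanSpace ℝ (Fin n)) :
    Laplacian.laplacian h x = ∑ i, fderiv ℝ (fderiv ℝ h) x (EuclideanSpace.single i 1)
      (EuclideanSpace.single i 1) := by
  rw [InnerProductSpace.laplacian_eq_iteratedFDeriv_orthonormalBasis h
    (EuclideanSpace.basisFun (Fin n) ℝ)]
  simp [iteratedFDeriv_two_apply]

lemma laplacian_polyFun {n : ℕ} (p : MvPolynomial (Fin n) ℝ) :
    Laplacian.laplacian (polyFun p) = polyFun (polyLaplacian n p) := by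
  ext x
  have h1 : fderiv ℝ (polyFun p) = fun y => ∑ i, polyFun (MvPolynomial.pderiv i p) y •
      (EuclideanSpace.proj i : EuclideanSpace ℝ (Fin n) →L[ℝ] ℝ) :=
    funext fun y => (hasFDerivAt_polyFun p y).fderiv
  have h2 : HasFDerivAt (fderiv ℝ (polyFun p)) (∑ i, (∑ j, polyFun (MvPolynomial.pderiv j
      (MvPolynomial.pderiv i p)) x •
      (EuclideanSpace.proj j : EuclideanSpace ℝ (Fin n) →L[ℝ] ℝ)).smulRight
      (EuclideanSpace.proj i : EuclideanSpace ℝ (Fin n) →L[ℝ] ℝ)) x := by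
    rw [h1]
    exact HasFDerivAt.fun_sum fun i _ =>
      (hasFDerivAt_polyFun (MvPolynomial.pderiv i p) x).smul_const
        (EuclideanSpace.proj i : EuclideanSpace ℝ (Fin n) →L[ℝ] ℝ)
  rw [laplacian_eq_sum, h2.fderiv, polyLaplacian_apply]
  simp [polyFun]

lemma polyFun_normSqPoly {n : ℕ} (x : EuclideanSpace ℝ (Fin n)) :
    polyFun (normSqPoly n) x = ‖x‖ ^ 2 := by
  simp [polyFun, normSqPoly, EuclideanSpace.norm_sq_eq]

lemma polyLaplacian_normSqPoly (n : ℕ) :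
    polyLaplacian n (normSqPoly n) = MvPolynomial.C (2 * n : ℝ) := by
  rw [polyLaplacian_apply]
  have (i : Fin n) : MvPolynomial.pderiv i (MvPolynomial.pderiv i (normSqPoly n)) =
      MvPolynomial.C 2 := by
    have h : MvPolynomial.pderiv i (normSqPoly n) = MvPolynomial.C 2 * MvPolynomial.X i := by
      rw [show (MvPolynomial.C 2 : MvPolynomial (Fin n) ℝ) = 2 from map_ofNat _ 2]
      simp only [normSqPoly, map_sum, MvPolynomial.pderiv_pow]
      rw [Finset.sum_eq_single i]
      · simp
      · intro j _ hj
        simp [MvPolynomial.pderiv_X_of_ne hj]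
      · simp
    rw [h, MvPolynomial.pderiv_C_mul, MvPolynomial.pderiv_X_self, mul_one]
  simp [this, mul_comm]

lemma laplacian_const_mul_normSq {n : ℕ} (a b : ℝ) (x : EuclideanSpace ℝ (Fin n)) :
    Laplacian.laplacian (fun y : EuclideanSpace ℝ (Fin n) => a * (‖y‖ ^ 2 - b)) x =
      2 * n * a := by
  have : (fun y : EuclideanSpace ℝ (Fin n) => a * (‖y‖ ^ 2 - b)) =
      polyFun (a • (normSqPoly n - MvPolynomial.C b)) := by
    ext y
    rw [← polyFun_normSqPoly]
    simp [polyFun]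
  rw [this, laplacian_polyFun, map_smul, map_sub, polyLaplacian_normSqPoly, polyLaplacian_apply]
  simp [polyFun]
  ring

/-! ### Viscosity inequalities for the Laplacian -/

/-- The inequality `Δw ≥ c` on the set `s`, in the viscosity sense: test functions touching `w` from
above at a point of `s` have Laplacian at least `c` there. -/
def ViscosityLaplacianGE {n : ℕ} (w : EuclideanSpace ℝ (Fin n) → ℝ)
    (s : Set (EuclideanSpace ℝ (Fin n))) (c : ℝ) : Prop :=
  ∀ x ∈ s, ∀ ψ : EuclideanSpace ℝ (Fin n) → ℝ, ContDiff ℝ 2 ψ →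
    IsLocalMax (fun y => w y - ψ y) x → c ≤ Laplacian.laplacian ψ x

lemma deriv_deriv_nonpos_of_isLocalMax {g : ℝ → ℝ} {t : ℝ} (hg : ContinuousAt g t)
    (h : IsLocalMax g t) : deriv (deriv g) t ≤ 0 := by
  by_contra! hpos
  have hmin := isLocalMin_of_deriv_deriv_pos hpos h.deriv_eq_zero hg
  have hc : g =ᶠ[𝓝 t] fun _ => g t := by
    filter_upwards [h, hmin] with s h1 h2 using le_antisymm h1 h2
  have := hc.deriv.deriv_eq
  simp at this
  linarith

lemma laplacian_nonpos_of_isLocalMax {n : ℕ} {h : EuclideanSpace ℝ (Fin n) → ℝ}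
    {x : EuclideanSpace ℝ (Fin n)} (hh : ContDiff ℝ 2 h) (hx : IsLocalMax h x) :
    Laplacian.laplacian h x ≤ 0 := by
  rw [laplacian_eq_sum]
  refine Finset.sum_nonpos fun i _ => ?_
  set e : EuclideanSpace ℝ (Fin n) := EuclideanSpace.single i 1
  have hl (t : ℝ) : HasDerivAt (fun t : ℝ => x + t • e) e t := by
    simpa using ((hasDerivAt_id t).smul_const e).const_add x
  have h1 : deriv (fun t : ℝ => h (x + t • e)) = fun t => fderiv ℝ h (x + t • e) e := by
    ext t
    exact (((hh.differentiable (by norm_num)) _).hasFDerivAt.comp_hasDerivAt t (hl t)).deriv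
  have h2 : HasDerivAt (fun t : ℝ => fderiv ℝ h (x + t • e) e) (fderiv ℝ (fderiv ℝ h) x e e) 0 := by
    have hd : Differentiable ℝ (fderiv ℝ h) :=
      (hh.fderiv_right (m := 1) (by norm_num)).differentiable (by norm_num)
    have h3 : HasDerivAt (fun t : ℝ => fderiv ℝ h (x + t • e))
        (fderiv ℝ (fderiv ℝ h) (x + (0 : ℝ) • e) e) 0 :=
      (hd (x + (0 : ℝ) • e)).hasFDerivAt.comp_hasDerivAt 0 (hl 0)
    rw [zero_smul, add_zero] at h3
    exact ((ContinuousLinearMap.apply ℝ ℝ e).hasFDerivAt.comp_hasDerivAt 0 h3)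
  rw [← h2.deriv, ← h1]
  refine deriv_deriv_nonpos_of_isLocalMax ?_ ?_
  · have := hh.continuous
    fun_prop
  · have := IsLocalMax.comp_continuous (f := h) (g := fun t : ℝ => x + t • e) (b := 0)
      (by simpa using hx) (by fun_prop)
    exact this

/-- A classical inequality `Δw ≥ c` is also a viscosity inequality. -/
lemma viscosityLaplacianGE_of_contDiff {n : ℕ} {w : EuclideanSpace ℝ (Fin n) → ℝ}
    {s : Set (EuclideanSpace ℝ (Fin n))} {c : ℝ} (hw : ContDiff ℝ 2 w)
    (h : ∀ x ∈ s, c ≤ Laplacian.laplacian w x) : ViscosityLaplacianGE w s c := by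
  intro x hx ψ hψ hmax
  have h1 := laplacian_nonpos_of_isLocalMax (hw.sub hψ) hmax
  have h2 := hw.contDiffAt.laplacian_sub (hψ.contDiffAt (x := x))
  have h3 := h x hx
  change Laplacian.laplacian (w - ψ) x ≤ 0 at h1
  linarith

lemma ViscosityLaplacianGE.comp_const_add {n : ℕ} {w : EuclideanSpace ℝ (Fin n) → ℝ}
    {s : Set (EuclideanSpace ℝ (Fin n))} {c : ℝ} (h : ViscosityLaplacianGE w s c)
    (z : EuclideanSpace ℝ (Fin n)) :
    ViscosityLaplacianGE (fun x => w (z + x)) ((fun x => z + x) ⁻¹' s) c := by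
  intro x hx ψ hψ hmax
  have h1 := h (z + x) hx (fun y => ψ (y - z)) (hψ.comp (contDiff_id.sub contDiff_const)) ?_
  · rw [laplacian_eq_sum] at h1 ⊢
    have e1 : fderiv ℝ (fun y => ψ (y - z)) = fun y => fderiv ℝ ψ (y - z) :=
      funext fun y => fderiv_comp_sub ..
    rw [e1, fderiv_comp_sub] at h1
    simpa using h1
  · have := IsLocalMax.comp_continuous (f := fun y => w (z + y) - ψ y) (g := fun y => y - z)
      (b := z + x) (by simpa using hmax) (by fun_prop)
    convert this using 2 with y
    simp [Function.comp]

/-- Comparison of a viscosity subsolution with a classical supersolution on a ball. -/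
lemma ViscosityLaplacianGE.le_of_le_on_sphere {n : ℕ} (hn : 0 < n)
    {w ψ : EuclideanSpace ℝ (Fin n) → ℝ} {r c : ℝ} (hw : UpperSemicontinuous w)
    (h : ViscosityLaplacianGE w (Metric.ball 0 r) c) (hψ : ContDiff ℝ 2 ψ)
    (hψc : ∀ x ∈ Metric.ball 0 r, Laplacian.laplacian ψ x ≤ c)
    (hs : ∀ x ∈ Metric.sphere 0 r, w x ≤ ψ x) {x : EuclideanSpace ℝ (Fin n)}
    (hx : x ∈ Metric.closedBall 0 r) : w x ≤ ψ x := by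
  -- Lowering the Laplacian of `ψ` strictly, an interior maximum of the difference is impossible.
  have key : ∀ ε > 0, w x ≤ ψ x + ε * (r ^ 2 - ‖x‖ ^ 2) := by
    intro ε hε
    set q : EuclideanSpace ℝ (Fin n) → ℝ := fun y => (-ε) * (‖y‖ ^ 2 - r ^ 2)
    have hq : ContDiff ℝ 2 q := by
      have := contDiff_norm_sq ℝ (E := EuclideanSpace ℝ (Fin n)) (n := 2)
      fun_prop
    have husc : UpperSemicontinuous fun y => w y - (ψ + q) y := by
      simp only [sub_eq_add_neg]
      exact hw.add (hψ.add hq).continuous.neg.upperSemicontinuous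
    obtain ⟨m, hm, hmax⟩ := (husc.upperSemicontinuousOn _).exists_isMaxOn ⟨x, hx⟩
      (isCompact_closedBall 0 r)
    have hle : w x - (ψ + q) x ≤ w m - (ψ + q) m := hmax hx
    suffices w m - (ψ + q) m ≤ 0 by
      have : w x - (ψ x + (-ε) * (‖x‖ ^ 2 - r ^ 2)) ≤ 0 := hle.trans this
      linarith
    rcases (Metric.mem_closedBall.1 hm).lt_or_eq with hlt | heq
    · exfalso
      have h1 := h m hlt (ψ + q) (hψ.add hq)
        (hmax.isLocalMax (Filter.mem_of_superset (Metric.isOpen_ball.mem_nhds hlt)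
          Metric.ball_subset_closedBall))
      rw [hψ.contDiffAt.laplacian_add hq.contDiffAt, laplacian_const_mul_normSq] at h1
      have := hψc m hlt
      have : (0:ℝ) < n := by exact_mod_cast hn
      have : 0 < ε * n := by positivity
      linarith
    · have h1 := hs m heq
      have h2 : q m = 0 := by simp [q, show ‖m‖ = r by simpa using heq]
      simp [h2, h1]
  have ht : Tendsto (fun ε : ℝ => ψ x + ε * (r ^ 2 - ‖x‖ ^ 2)) (𝓝[>] 0) (𝓝 (ψ x)) := by
    have : Tendsto (fun ε : ℝ => ψ x + ε * (r ^ 2 - ‖x‖ ^ 2)) (𝓝 0)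
        (𝓝 (ψ x + 0 * (r ^ 2 - ‖x‖ ^ 2))) := Continuous.tendsto (by fun_prop) 0
    simpa using this.mono_left nhdsWithin_le_nhds
  exact ge_of_tendsto ht (eventually_mem_nhdsWithin.mono key)

/-! ### Harmonic polynomials and the Dirichlet problem on a ball -/

lemma totalDegree_pderiv_le {n : ℕ} (i : Fin n) (p : MvPolynomial (Fin n) ℝ) :
    (MvPolynomial.pderiv i p).totalDegree ≤ p.totalDegree - 1 := by
  refine Finset.sup_le fun m hm => ?_
  rw [MvPolynomial.mem_support_iff, MvPolynomial.coeff_pderiv] at hm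
  have h := MvPolynomial.le_totalDegree (MvPolynomial.mem_support_iff.2 (left_ne_zero_of_mul hm))
  rw [Finsupp.sum_add_index' (by simp) (by simp)] at h
  simp only [Finsupp.sum_single_index] at h
  omega

lemma totalDegree_polyLaplacian_le {n : ℕ} (p : MvPolynomial (Fin n) ℝ) :
    (polyLaplacian n p).totalDegree ≤ p.totalDegree - 2 := by
  rw [polyLaplacian_apply]
  refine MvPolynomial.totalDegree_finsetSum_le fun i _ => ?_
  have h1 := totalDegree_pderiv_le i (MvPolynomial.pderiv i p)
  have h2 := totalDegree_pderiv_le i p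
  omega

lemma totalDegree_normSqPoly_le (n : ℕ) : (normSqPoly n).totalDegree ≤ 2 :=
  MvPolynomial.totalDegree_finsetSum_le fun i _ => by simp

/-- The maximum principle for harmonic polynomials. -/
lemma polyFun_le_of_le_on_sphere {n : ℕ} (hn : 0 < n) {r M : ℝ} {H : MvPolynomial (Fin n) ℝ}
    (hH : polyLaplacian n H = 0) (h : ∀ x ∈ Metric.sphere 0 r, polyFun H x ≤ M)
    {x : EuclideanSpace ℝ (Fin n)} (hx : x ∈ Metric.closedBall 0 r) : polyFun H x ≤ M := by
  refine ViscosityLaplacianGE.le_of_le_on_sphere (ψ := fun _ => M) (c := 0) hn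
    (contDiff_polyFun H (k := 2)).continuous.upperSemicontinuous
    (viscosityLaplacianGE_of_contDiff (contDiff_polyFun H) fun y _ => ?_) contDiff_const ?_ h hx
  · rw [laplacian_polyFun, hH]
    simp [polyFun]
  · simp

lemma polyFun_eq_zero_of_eq_zero_on_sphere {n : ℕ} (hn : 0 < n) {r : ℝ}
    {H : MvPolynomial (Fin n) ℝ} (hH : polyLaplacian n H = 0)
    (h : ∀ x ∈ Metric.sphere 0 r, polyFun H x = 0)
    {x : EuclideanSpace ℝ (Fin n)} (hx : x ∈ Metric.closedBall 0 r) : polyFun H x = 0 := by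
  refine le_antisymm (polyFun_le_of_le_on_sphere hn hH (fun y hy => (h y hy).le) hx) ?_
  have := polyFun_le_of_le_on_sphere hn (H := -H) (M := 0) (by simp [hH])
    (fun y hy => by simpa [polyFun] using (h y hy).ge) hx
  simpa [polyFun] using this

lemma eq_zero_of_polyFun_eq_zero_on_ball {n : ℕ} {r : ℝ} (hr : 0 < r)
    {p : MvPolynomial (Fin n) ℝ} (h : ∀ x ∈ Metric.ball 0 r, polyFun p x = 0) : p = 0 := by
  have hnhds : ∀ᶠ y : Fin n → ℝ in 𝓝 0, MvPolynomial.eval y p = 0 := by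
    have h1 : ContinuousAt (fun y : Fin n → ℝ => WithLp.toLp 2 y) 0 := by fun_prop
    have h2 := h1.eventually_mem (Metric.ball_mem_nhds _ hr)
    filter_upwards [h2] with y hy
    exact h _ hy
  obtain ⟨δ, hδ, hball⟩ := Metric.eventually_nhds_iff_ball.1 hnhds
  refine MvPolynomial.funext_set (fun _ => Ioo (-δ) δ)
    (fun _ => Ioo_infinite (by linarith)) fun y hy => ?_
  rw [hball y ?_, map_zero]
  rw [mem_ball_zero_iff, pi_norm_lt_iff hδ]
  exact fun i => abs_lt.2 (hy i (mem_univ i))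

/-- The Dirichlet problem on a ball with polynomial boundary data has a polynomial solution.
It is obtained by subtracting `(r² - |x|²) s` from the datum `q`, where `s` is such that
`Δ((r² - |x|²) s) = Δq`. On polynomials of bounded degree, the operator `s ↦ Δ((r² - |x|²) s)`
is injective by the maximum principle, hence surjective. -/
lemma exists_harmonic_polynomial_eq_on_sphere {n : ℕ} (hn : 0 < n) {r : ℝ} (hr : 0 < r)
    (q : MvPolynomial (Fin n) ℝ) : ∃ H, polyLaplacian n H = 0 ∧
      ∀ x : EuclideanSpace ℝ (Fin n), x ∈ Metric.sphere 0 r → polyFun H x = polyFun q x := by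
  set b : MvPolynomial (Fin n) ℝ := MvPolynomial.C (r ^ 2) - normSqPoly n
  have hb (x : EuclideanSpace ℝ (Fin n)) : polyFun b x = r ^ 2 - ‖x‖ ^ 2 := by
    rw [← polyFun_normSqPoly]; simp [polyFun, b]
  have hbdeg : b.totalDegree ≤ 2 :=
    (MvPolynomial.totalDegree_sub _ _).trans (max_le
      ((MvPolynomial.totalDegree_C _).trans_le (by simp)) (totalDegree_normSqPoly_le n))
  have hmul (s : MvPolynomial (Fin n) ℝ) (x : EuclideanSpace ℝ (Fin n)) :
      polyFun (b * s) x = (r ^ 2 - ‖x‖ ^ 2) * polyFun s x := by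
    rw [← hb]; simp [polyFun]
  set V := MvPolynomial.restrictTotalDegree (Fin n) ℝ q.totalDegree
  have hmaps : ∀ s ∈ V, (polyLaplacian n ∘ₗ LinearMap.mulLeft ℝ b) s ∈ V := by
    intro s hs
    rw [MvPolynomial.mem_restrictTotalDegree] at hs ⊢
    have h1 := totalDegree_polyLaplacian_le (b * s)
    have h2 := MvPolynomial.totalDegree_mul b s
    simp only [LinearMap.comp_apply, LinearMap.mulLeft_apply]
    omega
  set M : V →ₗ[ℝ] V := (polyLaplacian n ∘ₗ LinearMap.mulLeft ℝ b).restrict hmaps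
  have hinj : Function.Injective M := by
    rw [← LinearMap.ker_eq_bot, LinearMap.ker_eq_bot']
    intro s hs
    have h0 : polyLaplacian n (b * s) = 0 := congrArg Subtype.val hs
    refine Subtype.ext (eq_zero_of_polyFun_eq_zero_on_ball hr fun x hx => ?_)
    have h1 := polyFun_eq_zero_of_eq_zero_on_sphere hn h0 (r := r)
      (fun y hy => by rw [hmul, mem_sphere_zero_iff_norm.1 hy]; ring)
      (Metric.ball_subset_closedBall hx)
    rw [hmul] at h1
    refine (mul_eq_zero.1 h1).resolve_left (ne_of_gt ?_)
    have := mem_ball_zero_iff.1 hx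
    have := norm_nonneg x
    nlinarith
  obtain ⟨s, hs⟩ := LinearMap.injective_iff_surjective.1 hinj ⟨polyLaplacian n q, by
    rw [MvPolynomial.mem_restrictTotalDegree]
    have := totalDegree_polyLaplacian_le q
    omega⟩
  have hs' : polyLaplacian n (b * s) = polyLaplacian n q := congrArg Subtype.val hs
  refine ⟨q - b * s, by rw [map_sub, hs', sub_self], fun x hx => ?_⟩
  have := hmul s x
  rw [mem_sphere_zero_iff_norm.1 hx, sub_self, zero_mul] at this
  simpa [polyFun] using this

/-- A polynomial as a continuous function on a sphere centred at the origin. -/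
noncomputable def spherePoly (n : ℕ) (r : ℝ) :
    MvPolynomial (Fin n) ℝ →ₐ[ℝ] C(Metric.sphere (0 : EuclideanSpace ℝ (Fin n)) r, ℝ) :=
  MvPolynomial.aeval fun i => ⟨fun x => x.1 i, by fun_prop⟩

lemma spherePoly_apply {n : ℕ} {r : ℝ} (p : MvPolynomial (Fin n) ℝ)
    (x : Metric.sphere (0 : EuclideanSpace ℝ (Fin n)) r) : spherePoly n r p x = polyFun p x := by
  induction p using MvPolynomial.induction_on with
  | C a => simp [spherePoly, polyFun]
  | add p q hp hq => rw [map_add, ContinuousMap.add_apply, hp, hq, polyFun_add]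
  | mul_X p j hp => rw [map_mul, ContinuousMap.mul_apply, hp, polyFun_mul_X]; simp [spherePoly]

/-- Harmonic polynomials are dense among continuous functions on a sphere. -/
lemma exists_harmonic_polynomial_near {n : ℕ} (hn : 0 < n) {r : ℝ} (hr : 0 < r)
    (φ : C(Metric.sphere (0 : EuclideanSpace ℝ (Fin n)) r, ℝ)) {ε : ℝ} (hε : 0 < ε) :
    ∃ H, polyLaplacian n H = 0 ∧ ∀ x, |polyFun H x.1 - φ x| < ε := by
  have hdense := ContinuousMap.subalgebra_topologicalClosure_eq_top_of_separatesPoints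
    (spherePoly n r).range (by
      intro x y hxy
      obtain ⟨i, hi⟩ : ∃ i, x.1 i ≠ y.1 i := by
        by_contra! h
        exact hxy (Subtype.ext (PiLp.ext h))
      exact ⟨_, ⟨spherePoly n r (MvPolynomial.X i), ⟨_, rfl⟩, rfl⟩, by
        simpa [spherePoly_apply, polyFun] using hi⟩)
  have hφ : φ ∈ (spherePoly n r).range.topologicalClosure := hdense ▸ Algebra.mem_top
  obtain ⟨_, ⟨q, rfl⟩, hq⟩ := Metric.mem_closure_iff.1 hφ ε hε
  obtain ⟨H, hH, hHq⟩ := exists_harmonic_polynomial_eq_on_sphere hn hr q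
  refine ⟨H, hH, fun x => ?_⟩
  rw [hHq x x.2, ← spherePoly_apply, ← Real.dist_eq, dist_comm]
  exact (ContinuousMap.dist_apply_le_dist x).trans_lt hq

/-- A linear functional on `C(∂B)` that represents harmonic polynomials by their value at the centre
of the ball `B` and is bounded above by the maximum. (It is the spherical mean; only these
properties are needed.) -/
structure IsHarmonicMean {n : ℕ} {r : ℝ}
    (T : C(Metric.sphere (0 : EuclideanSpace ℝ (Fin n)) r, ℝ) →L[ℝ] ℝ) : Prop where
  le_of_le : ∀ φ M, (∀ x, φ x ≤ M) → T φ ≤ M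
  apply_harmonic : ∀ H, polyLaplacian n H = 0 → T (spherePoly n r H) = polyFun H 0

lemma exists_isHarmonicMean {n : ℕ} (hn : 0 < n) {r : ℝ} (hr : 0 < r) :
    ∃ T : C(Metric.sphere (0 : EuclideanSpace ℝ (Fin n)) r, ℝ) →L[ℝ] ℝ, IsHarmonicMean T := by
  have : Nonempty (Fin n) := ⟨⟨0, hn⟩⟩
  have : Nonempty (Metric.sphere (0 : EuclideanSpace ℝ (Fin n)) r) :=
    (NormedSpace.sphere_nonempty.2 hr.le).to_subtype
  have hbdd (φ : C(Metric.sphere (0 : EuclideanSpace ℝ (Fin n)) r, ℝ)) : BddAbove (range φ) :=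
    (isCompact_range φ.continuous).bddAbove
  have h0 : (0 : EuclideanSpace ℝ (Fin n)) ∈ Metric.closedBall 0 r :=
    Metric.mem_closedBall_self hr.le
  let W := LinearMap.ker (polyLaplacian n)
  let L : W →ₗ[ℝ] C(Metric.sphere (0 : EuclideanSpace ℝ (Fin n)) r, ℝ) :=
    (spherePoly n r).toLinearMap ∘ₗ W.subtype
  obtain ⟨s, hs⟩ := L.rangeRestrict.exists_rightInverse_of_surjective L.range_rangeRestrict
  have hs' (y : L.range) (x : Metric.sphere (0 : EuclideanSpace ℝ (Fin n)) r) :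
      polyFun (s y).1 x = y.1 x := by
    rw [← spherePoly_apply]
    exact congrArg (fun z : L.range => z.1 x) (LinearMap.congr_fun hs y)
  let ev : MvPolynomial (Fin n) ℝ →ₗ[ℝ] ℝ :=
    (MvPolynomial.aeval (0 : EuclideanSpace ℝ (Fin n)).ofLp).toLinearMap
  have hev (p) : ev p = polyFun p 0 := by simp [ev, polyFun]
  obtain ⟨g, hg, hgle⟩ := exists_extension_of_le_sublinear
    ⟨L.range, ev ∘ₗ W.subtype ∘ₗ s⟩ (fun φ => ⨆ x, φ x)
    (fun c hc φ => by simp [Real.mul_iSup_of_nonneg hc.le])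
    (fun φ ψ => ciSup_le fun x => add_le_add (le_ciSup (hbdd φ) x) (le_ciSup (hbdd ψ) x))
    (fun y => by
      change ev (s y).1 ≤ _
      rw [hev]
      exact polyFun_le_of_le_on_sphere hn (s y).2
        (fun x hx => (hs' y ⟨x, hx⟩).le.trans (le_ciSup (hbdd y.1) ⟨x, hx⟩)) h0)
  have hle (φ M) (h : ∀ x, φ x ≤ M) : g φ ≤ M := (hgle φ).trans (ciSup_le h)
  refine ⟨g.mkContinuous 1 fun φ => ?_, hle, fun H hH => ?_⟩
  · rw [one_mul, Real.norm_eq_abs, abs_le']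
    refine ⟨hle _ _ fun x => (le_abs_self _).trans (φ.norm_coe_le_norm x), ?_⟩
    rw [← map_neg]
    exact hle _ _ fun x => (neg_le_abs _).trans (φ.norm_coe_le_norm x)
  · have hgH : g (spherePoly n r H) = ev (s ⟨_, ⟨⟨H, hH⟩, rfl⟩⟩).1 := hg ⟨_, ⟨⟨H, hH⟩, rfl⟩⟩
    rw [LinearMap.mkContinuous_apply, hgH, hev]
    set y : L.range := ⟨L ⟨H, hH⟩, ⟨⟨H, hH⟩, rfl⟩⟩
    have := polyFun_eq_zero_of_eq_zero_on_sphere hn (H := (s y).1 - H) (r := r)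
      (by rw [map_sub, (s y).2, hH, sub_zero])
      (fun x hx => by
        have h1 := hs' y ⟨x, hx⟩
        have h2 : y.1 ⟨x, hx⟩ = polyFun H x := spherePoly_apply H ⟨x, hx⟩
        rw [h2] at h1
        simpa [polyFun, sub_eq_zero] using h1) h0
    simpa [polyFun, sub_eq_zero] using this

/-- The restriction to the sphere of radius `r` of `x ↦ w (z + x)`. -/
def sphereRestrict {n : ℕ} (r : ℝ) {w : EuclideanSpace ℝ (Fin n) → ℝ} (hw : Continuous w)
    (z : EuclideanSpace ℝ (Fin n)) : C(Metric.sphere (0 : EuclideanSpace ℝ (Fin n)) r, ℝ) :=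
  ⟨fun x => w (z + x), by fun_prop⟩

/-- The sub-mean value inequality for continuous functions with `Δw ≥ c` in the viscosity sense. -/
lemma ViscosityLaplacianGE.le_harmonicMean {n : ℕ} (hn : 0 < n) {r : ℝ} (hr : 0 < r)
    {T : C(Metric.sphere (0 : EuclideanSpace ℝ (Fin n)) r, ℝ) →L[ℝ] ℝ} (hT : IsHarmonicMean T)
    {w : EuclideanSpace ℝ (Fin n) → ℝ} (hw : Continuous w) {z : EuclideanSpace ℝ (Fin n)} {c : ℝ}
    (h : ViscosityLaplacianGE w (Metric.ball z r) c) :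
    w z ≤ T (sphereRestrict r hw z) - c * r ^ 2 / (2 * n) := by
  have hn' : (0 : ℝ) < n := by exact_mod_cast hn
  refine le_of_forall_pos_le_add fun ε hε => ?_
  obtain ⟨H₀, hH₀, hHw⟩ :=
    exists_harmonic_polynomial_near hn hr (sphereRestrict r hw z) (half_pos hε)
  set H := H₀ + MvPolynomial.C (ε / 2)
  have hH : polyLaplacian n H = 0 := by
    rw [map_add, hH₀]
    simp [polyLaplacian_apply]
  have hHw' (x : Metric.sphere (0 : EuclideanSpace ℝ (Fin n)) r) :
      sphereRestrict r hw z x ≤ polyFun H x ∧ polyFun H x ≤ sphereRestrict r hw z x + ε := by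
    have h1 := abs_lt.1 (hHw x)
    have h2 : polyFun H x.1 = polyFun H₀ x + ε / 2 := by simp [H, polyFun]
    constructor <;> linarith
  -- The solution of `Δψ = c` with boundary values close to those of `w`.
  set q : EuclideanSpace ℝ (Fin n) → ℝ := fun y => c / (2 * n) * (‖y‖ ^ 2 - r ^ 2)
  have hq : ContDiff ℝ 2 q := by
    have := contDiff_norm_sq ℝ (E := EuclideanSpace ℝ (Fin n)) (n := 2)
    fun_prop
  have hw0 := ViscosityLaplacianGE.le_of_le_on_sphere (r := r) (c := c) (ψ := polyFun H + q)
    (w := fun x => w (z + x)) (x := 0) hn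
    (hw.comp (continuous_const.add continuous_id)).upperSemicontinuous
    (by simpa using! h.comp_const_add z) ((contDiff_polyFun H).add hq)
    (fun x _ => by
      rw [(contDiff_polyFun H).contDiffAt.laplacian_add hq.contDiffAt, laplacian_polyFun, hH,
        laplacian_const_mul_normSq]
      simp only [polyFun, map_zero, zero_add]
      field_simp
      rfl)
    (fun x hx => by
      have h2 : q x = 0 := by simp [q, mem_sphere_zero_iff_norm.1 hx]
      rw [Pi.add_apply, h2, add_zero]
      exact (hHw' ⟨x, hx⟩).1)
    (Metric.mem_closedBall_self hr.le)
  have hTH : T (spherePoly n r H - sphereRestrict r hw z) ≤ ε := by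
    refine hT.le_of_le _ _ fun x => ?_
    have := (hHw' x).2
    rw [ContinuousMap.sub_apply, spherePoly_apply]
    linarith
  rw [map_sub, hT.apply_harmonic H hH] at hTH
  have hq0 : q 0 = - (c * r ^ 2 / (2 * n)) := by simp [q]; ring
  simp only [add_zero, Pi.add_apply, hq0] at hw0
  linarith

/-! ### Mollification -/

open MeasureTheory in
/-- The average of `u` with respect to the normalized bump function `φ`. -/
noncomputable def mollify {n : ℕ} (φ : ContDiffBump (0 : EuclideanSpace ℝ (Fin n)))
    (u : EuclideanSpace ℝ (Fin n) → ℝ) (z : EuclideanSpace ℝ (Fin n)) : ℝ :=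
  ∫ y, φ.normed volume y * u (z - y)

lemma contDiff_mollify {n : ℕ} (φ : ContDiffBump (0 : EuclideanSpace ℝ (Fin n)))
    {u : EuclideanSpace ℝ (Fin n) → ℝ} (hu : Continuous u) : ContDiff ℝ 2 (mollify φ u) :=
  φ.hasCompactSupport_normed.contDiff_convolution_left (n := 2) (ContinuousLinearMap.lsmul ℝ ℝ)
    (φ.contDiff_normed (n := 2)) hu.locallyIntegrable

lemma dist_mollify_le {n : ℕ} (φ : ContDiffBump (0 : EuclideanSpace ℝ (Fin n)))
    {u : EuclideanSpace ℝ (Fin n) → ℝ} (hu : Continuous u) {z : EuclideanSpace ℝ (Fin n)} {ε : ℝ}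
    (h : ∀ x ∈ Metric.ball z φ.rOut, dist (u x) (u z) ≤ ε) : dist (mollify φ u z) (u z) ≤ ε :=
  φ.dist_normed_convolution_le hu.aestronglyMeasurable h

open MeasureTheory in
lemma integrable_normed_smul {n : ℕ} {F : Type*} [NormedAddCommGroup F] [NormedSpace ℝ F]
    (φ : ContDiffBump (0 : EuclideanSpace ℝ (Fin n)))
    {g : EuclideanSpace ℝ (Fin n) → F} (hg : Continuous g) :
    Integrable fun y => φ.normed volume y • g y :=
  (φ.continuous_normed.smul hg).integrable_of_hasCompactSupport
    φ.hasCompactSupport_normed.smul_right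

open MeasureTheory in
lemma lipschitzWith_mollify {n : ℕ} (φ : ContDiffBump (0 : EuclideanSpace ℝ (Fin n)))
    {u : EuclideanSpace ℝ (Fin n) → ℝ} (hu : LipschitzWith 1 u) :
    LipschitzWith 1 (mollify φ u) := by
  have hint (z : EuclideanSpace ℝ (Fin n)) : Integrable fun y => φ.normed volume y * u (z - y) :=
    integrable_normed_smul φ (hu.continuous.comp (continuous_const.sub continuous_id))
  refine LipschitzWith.of_le_add_mul 1 fun z z' => ?_
  have h1 : mollify φ u z' + (1 : NNReal) * dist z z' =
      ∫ y, (φ.normed volume y * u (z' - y) + φ.normed volume y * dist z z') := by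
    rw [integral_add (hint z') (φ.integrable_normed.mul_const _), integral_mul_const,
      φ.integral_normed, mollify, NNReal.coe_one]
  rw [h1]
  refine integral_mono (hint z) ((hint z').add (φ.integrable_normed.mul_const _)) fun y => ?_
  have h2 := hu.le_add_mul (z - y) (z' - y)
  rw [dist_sub_right, NNReal.coe_one, one_mul] at h2
  have := mul_le_mul_of_nonneg_left h2 (φ.nonneg_normed (μ := volume) y)
  simp only
  linarith

open MeasureTheory in
/-- The sub-mean value inequality is inherited by averages of translates. -/
lemma mollify_le_harmonicMean {n : ℕ} (hn : 0 < n) {r : ℝ} (hr : 0 < r)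
    {T : C(Metric.sphere (0 : EuclideanSpace ℝ (Fin n)) r, ℝ) →L[ℝ] ℝ} (hT : IsHarmonicMean T)
    (φ : ContDiffBump (0 : EuclideanSpace ℝ (Fin n)))
    {u : EuclideanSpace ℝ (Fin n) → ℝ} (hu : Continuous u) {z : EuclideanSpace ℝ (Fin n)} {c : ℝ}
    (h : ViscosityLaplacianGE u (Metric.ball z (φ.rOut + r)) c) :
    mollify φ u z ≤
      T (sphereRestrict r (contDiff_mollify φ hu).continuous z) - c * r ^ 2 / (2 * n) := by
  set G : EuclideanSpace ℝ (Fin n) → C(Metric.sphere (0 : EuclideanSpace ℝ (Fin n)) r, ℝ) :=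
    fun y => sphereRestrict r hu (z - y)
  have hG : Continuous G :=
    ContinuousMap.continuous_of_continuous_uncurry _ (by
      change Continuous fun p : EuclideanSpace ℝ (Fin n) ×
        Metric.sphere (0 : EuclideanSpace ℝ (Fin n)) r => u (z - p.1 + p.2)
      fun_prop)
  have hGint := integrable_normed_smul φ hG
  have hGval : ∫ y, φ.normed volume y • G y =
      sphereRestrict r (contDiff_mollify φ hu).continuous z := by
    ext x
    rw [ContinuousMap.integral_apply hGint]
    change ∫ y, φ.normed volume y * u (z - y + x) = ∫ y, φ.normed volume y * u (z + x - y)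
    simp only [sub_add_eq_add_sub]
  have hTint : Integrable fun y => φ.normed volume y * T (G y) :=
    integrable_normed_smul φ (T.continuous.comp hG)
  have hT1 : T (sphereRestrict r (contDiff_mollify φ hu).continuous z) - c * r ^ 2 / (2 * n) =
      ∫ y, (φ.normed volume y * T (G y) - φ.normed volume y * (c * r ^ 2 / (2 * n))) := by
    rw [integral_sub hTint (φ.integrable_normed.mul_const _), integral_mul_const,
      φ.integral_normed, one_mul, ← hGval,
      ← T.integral_comp_comm hGint]
    simp
  rw [hT1]
  refine integral_mono
    (integrable_normed_smul φ (hu.comp (continuous_const.sub continuous_id)))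
    (hTint.sub (φ.integrable_normed.mul_const _)) fun y => ?_
  simp only
  by_cases hy : y ∈ Metric.ball 0 φ.rOut
  · rw [← mul_sub]
    refine mul_le_mul_of_nonneg_left (ViscosityLaplacianGE.le_harmonicMean hn hr hT hu
      fun x hx => h x ?_) (φ.nonneg_normed y)
    refine Metric.ball_subset_ball' ?_ hx
    have := mem_ball_zero_iff.1 hy
    rw [dist_eq_norm, sub_sub_cancel_left, norm_neg]
    linarith
  · have : φ.normed volume y = 0 := by
      rwa [← Function.notMem_support, φ.support_normed_eq]
    simp [this]

lemma continuous_laplacian {n : ℕ} {U : EuclideanSpace ℝ (Fin n) → ℝ} (hU : ContDiff ℝ 2 U) :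
    Continuous (Laplacian.laplacian U) := by
  rw [funext (laplacian_eq_sum U)]
  have : Continuous (fderiv ℝ (fderiv ℝ U)) :=
    (hU.fderiv_right (m := 1) (by norm_num)).continuous_fderiv (by norm_num)
  fun_prop

/-- A viscosity lower bound for the Laplacian turns into a classical one after mollification. The
mollified function satisfies the sub-mean value inequality for `c`, and if its Laplacian were below
some `c' < c` near `z`, its opposite would satisfy the one for `-c'`. -/
lemma le_laplacian_mollify {n : ℕ} (hn : 0 < n)
    (φ : ContDiffBump (0 : EuclideanSpace ℝ (Fin n)))
    {u : EuclideanSpace ℝ (Fin n) → ℝ} (hu : Continuous u) {z : EuclideanSpace ℝ (Fin n)} {c R : ℝ}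
    (hR : φ.rOut < R) (h : ViscosityLaplacianGE u (Metric.ball z R) c) :
    c ≤ Laplacian.laplacian (mollify φ u) z := by
  by_contra! hlt
  obtain ⟨c', hc', hc'c⟩ := exists_between hlt
  have hU := contDiff_mollify φ hu
  obtain ⟨r₀, hr₀, hball⟩ := Metric.eventually_nhds_iff_ball.1
    ((continuous_laplacian hU).continuousAt.eventually_lt_const hc')
  set r := min r₀ (R - φ.rOut)
  have hr : 0 < r := lt_min hr₀ (sub_pos.2 hR)
  obtain ⟨T, hT⟩ := exists_isHarmonicMean hn hr
  have h1 := mollify_le_harmonicMean hn hr hT φ hu fun x hx => h x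
    (Metric.ball_subset_ball (by linarith [min_le_right r₀ (R - φ.rOut)]) hx)
  have h2 := (viscosityLaplacianGE_of_contDiff (s := Metric.ball z r) (c := -c') hU.neg
    fun x hx => by
      have := hball x (Metric.ball_subset_ball (min_le_left _ _) hx)
      have h3 : Laplacian.laplacian (-mollify φ u) x = -Laplacian.laplacian (mollify φ u) x := by
        rw [InnerProductSpace.laplacian_neg]; rfl
      change -c' ≤ Laplacian.laplacian (-mollify φ u) x
      linarith).le_harmonicMean hn hr hT hU.neg.continuous
  have h4 : sphereRestrict r hU.neg.continuous z = -sphereRestrict r hU.continuous z := rfl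
  rw [h4, map_neg] at h2
  have : (0 : ℝ) < n := by exact_mod_cast hn
  have h5 : c' * r ^ 2 / (2 * n) < c * r ^ 2 / (2 * n) := by gcongr
  have h6 : -c' * r ^ 2 / (2 * n) = -(c' * r ^ 2 / (2 * n)) := by ring
  linarith

/-! ### Growth at infinity and Lipschitz bound for subsolutions -/

lemma exists_forall_le_of_upperSemicontinuous {n : ℕ} {g : EuclideanSpace ℝ (Fin n) → ℝ}
    (hg : UpperSemicontinuous g) {x₀ : EuclideanSpace ℝ (Fin n)} {R : ℝ}
    (h : ∀ x, R < ‖x‖ → g x < g x₀) : ∃ m, ‖m‖ ≤ R ∧ ∀ x, g x ≤ g m := by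
  have hx₀ : ‖x₀‖ ≤ R := by
    by_contra! hlt
    exact (h x₀ hlt).false
  obtain ⟨m, hm, hmax⟩ := (hg.upperSemicontinuousOn (Metric.closedBall 0 R)).exists_isMaxOn
    ⟨x₀, by simpa using hx₀⟩ (isCompact_closedBall 0 R)
  refine ⟨m, by simpa using hm, fun x => ?_⟩
  rcases le_or_gt ‖x‖ R with hx | hx
  · exact hmax (by simpa using hx)
  · exact (h x hx).le.trans (hmax (by simpa using hx₀))

lemma exists_radius_of_eventually_cobounded {n : ℕ} {P : EuclideanSpace ℝ (Fin n) → Prop}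
    (h : ∀ᶠ x in Bornology.cobounded (EuclideanSpace ℝ (Fin n)), P x) :
    ∃ R : ℝ, ∀ x, R < ‖x‖ → P x := by
  rw [← comap_norm_atTop, eventually_comap] at h
  obtain ⟨R, hR⟩ := eventually_atTop.1 h
  exact ⟨R, fun x hx => hR ‖x‖ hx.le x rfl⟩

lemma exists_radius_le_mul_norm {n : ℕ} {u : EuclideanSpace ℝ (Fin n) → ℝ}
    (hu : limsupGrowth u ≤ 1) {K : ℝ} (hK : 1 < K) : ∃ R : ℝ, ∀ x, R < ‖x‖ → u x ≤ K * ‖x‖ := by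
  have h1 : limsupGrowth u < (K : EReal) := hu.trans_lt (by exact_mod_cast hK)
  have h2 := (eventually_lt_of_limsup_lt h1).and
    (tendsto_norm_cobounded_atTop.eventually_gt_atTop 0)
  refine exists_radius_of_eventually_cobounded (h2.mono fun x hx => ?_)
  exact ((div_lt_iff₀ hx.2).1 (EReal.coe_lt_coe_iff.1 hx.1)).le

lemma exists_radius_mul_norm_le {n : ℕ} {v : EuclideanSpace ℝ (Fin n) → ℝ}
    (hv : 1 ≤ liminfGrowth v) {κ : ℝ} (hκ : κ < 1) : ∃ R : ℝ, ∀ x, R < ‖x‖ → κ * ‖x‖ ≤ v x := by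
  have h1 : (κ : EReal) < liminfGrowth v := lt_of_lt_of_le (by exact_mod_cast hκ) hv
  have h2 := (eventually_lt_of_lt_liminf h1).and
    (tendsto_norm_cobounded_atTop.eventually_gt_atTop 0)
  refine exists_radius_of_eventually_cobounded (h2.mono fun x hx => ?_)
  exact ((lt_div_iff₀ hx.2).1 (EReal.coe_lt_coe_iff.1 hx.1)).le

lemma norm_gradient_eq {n : ℕ} (φ : EuclideanSpace ℝ (Fin n) → ℝ) (x : EuclideanSpace ℝ (Fin n)) :
    ‖gradient φ x‖ = ‖fderiv ℝ φ x‖ :=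
  LinearIsometryEquiv.norm_map _ _

/-- At a point where the smoothed cone `K √(‖x - y‖² + δ²)` with `K > 1` has slope at most one, the
distance to the vertex is of order `δ`. -/
lemma norm_sub_le_of_norm_gradient_cone_le {n : ℕ} {K δ : ℝ} (hK : 1 < K) (hδ : 0 < δ)
    {m y : EuclideanSpace ℝ (Fin n)}
    (h : ‖gradient (fun x => K * √(‖x - y‖ ^ 2 + δ ^ 2)) m‖ ≤ 1) :
    (K ^ 2 - 1) * ‖m - y‖ ^ 2 ≤ δ ^ 2 := by
  set d := ‖m - y‖
  have hpos : 0 < d ^ 2 + δ ^ 2 := by positivity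
  set s := √(d ^ 2 + δ ^ 2)
  have hs : 0 < s := Real.sqrt_pos.2 hpos
  have hs2 : s ^ 2 = d ^ 2 + δ ^ 2 := Real.sq_sqrt hpos.le
  have hderiv : HasFDerivAt (fun x : EuclideanSpace ℝ (Fin n) => K * √(‖x - y‖ ^ 2 + δ ^ 2))
      (K • ((1 / (2 * s)) • ((2 : ℕ) • innerSL ℝ (m - y)))) m := by
    have h1 : HasFDerivAt (fun x : EuclideanSpace ℝ (Fin n) => ‖x - y‖ ^ 2)
        ((2 : ℕ) • innerSL ℝ (m - y)) m := by
      have h2 := ((hasFDerivAt_id m).sub_const y).norm_sq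
      simpa using! h2
    exact ((h1.add_const (δ ^ 2)).sqrt hpos.ne').const_mul K
  rw [norm_gradient_eq, hderiv.fderiv] at h
  have h3 := ContinuousLinearMap.le_of_opNorm_le _ h (m - y)
  have h4 : (K • ((1 / (2 * s)) • ((2 : ℕ) • innerSL ℝ (m - y)))) (m - y) = K * d ^ 2 / s := by
    simp only [smul_apply, innerSL_apply_apply, real_inner_self_eq_norm_sq,
      smul_eq_mul, nsmul_eq_mul]
    change K * (1 / (2 * s) * (((2 : ℕ) : ℝ) * d ^ 2)) = _
    push_cast
    field_simp
  rw [h4, one_mul] at h3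
  have h5 : K * d ^ 2 ≤ d * s := (div_le_iff₀ hs).1 ((le_abs_self _).trans h3)
  rcases (norm_nonneg (m - y)).eq_or_lt with h0 | h0
  · simp only [d, ← h0]
    nlinarith
  · have h6 : K * d ≤ s := by
      refine le_of_mul_le_mul_left ?_ h0
      linarith [h5, show d * (K * d) = K * d ^ 2 by ring]
    have h7 : (K * d) ^ 2 ≤ s ^ 2 := by gcongr
    nlinarith

/-- The gradient constraint makes subsolutions of at most unit linear growth `1`-Lipschitz: for
`K > 1` the function `u` can only touch smoothed cones of slope `K` near their vertex. -/
lemma IsViscositySubsolution.lipschitzWith {n : ℕ} {f : EuclideanSpace ℝ (Fin n) → ℝ} {lam : ℝ}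
    {u : EuclideanSpace ℝ (Fin n) → ℝ} (hu : IsViscositySubsolution f lam u)
    (hgrowth : limsupGrowth u ≤ 1) : LipschitzWith 1 u := by
  refine LipschitzWith.of_le_add fun x y => ?_
  suffices key : ∀ K > 1, ∀ η > 0, u x ≤ u y + η + K * (‖x - y‖ + η) by
    have ht : Tendsto (fun t : ℝ => u y + t + (1 + t) * (‖x - y‖ + t)) (𝓝[>] 0)
        (𝓝 (u y + dist x y)) := by
      have : Tendsto (fun t : ℝ => u y + t + (1 + t) * (‖x - y‖ + t)) (𝓝 0)
          (𝓝 (u y + 0 + (1 + 0) * (‖x - y‖ + 0))) := Continuous.tendsto (by fun_prop) 0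
      simpa [dist_eq_norm] using this.mono_left nhdsWithin_le_nhds
    refine ge_of_tendsto ht (eventually_mem_nhdsWithin.mono fun t ht => ?_)
    have ht : 0 < t := ht
    exact key (1 + t) (by linarith) t ht
  intro K hK η hη
  obtain ⟨ρ, hρ, hball⟩ := Metric.eventually_nhds_iff_ball.1
    (hu.1 y (u y + η) (by linarith))
  have hK2 : 0 < K ^ 2 - 1 := by nlinarith
  obtain ⟨δ, hδ, hδη, hδρ⟩ : ∃ δ > 0, δ ≤ η ∧ δ ^ 2 < (K ^ 2 - 1) * ρ ^ 2 := by
    have h1 : ∀ᶠ δ : ℝ in 𝓝[>] 0, δ ^ 2 < (K ^ 2 - 1) * ρ ^ 2 := by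
      have h2 : Tendsto (fun δ : ℝ => δ ^ 2) (𝓝 0) (𝓝 (0 ^ 2)) := Continuous.tendsto (by fun_prop) 0
      exact (h2.mono_left nhdsWithin_le_nhds).eventually_lt_const (by
        rw [zero_pow two_ne_zero]
        positivity)
    obtain ⟨δ, ⟨h2, h3⟩, h4⟩ :=
      ((h1.and (Ioc_mem_nhdsGT hη)).and self_mem_nhdsWithin).exists
    exact ⟨δ, h4, h3.2, h2⟩
  set φ : EuclideanSpace ℝ (Fin n) → ℝ := fun x => K * √(‖x - y‖ ^ 2 + δ ^ 2)
  have hφ : ContDiff ℝ 2 φ := by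
    have hne : ∀ x : EuclideanSpace ℝ (Fin n), ‖x - y‖ ^ 2 + δ ^ 2 ≠ 0 :=
      fun x => by positivity
    exact contDiff_const.mul ((((contDiff_id.sub contDiff_const).norm_sq ℝ).add
      contDiff_const).sqrt hne)
  have hφle (x) : φ x ≤ K * (‖x - y‖ + δ) := by
    refine mul_le_mul_of_nonneg_left ?_ (by linarith)
    refine Real.sqrt_le_iff.2 ⟨by positivity, ?_⟩
    nlinarith [norm_nonneg (x - y)]
  have hleφ (x) : K * ‖x - y‖ ≤ φ x :=
    mul_le_mul_of_nonneg_left (Real.le_sqrt_of_sq_le (by nlinarith)) (by linarith)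
  obtain ⟨R, hR⟩ := exists_radius_le_mul_norm hgrowth (K := (1 + K) / 2) (by linarith)
  obtain ⟨m, -, hm⟩ := exists_forall_le_of_upperSemicontinuous (g := fun x => u x - φ x) (x₀ := y)
    (R := max R ((K * ‖y‖ - (u y - φ y)) / ((K - 1) / 2)))
    (by
      simp only [sub_eq_add_neg]
      exact hu.1.add hφ.continuous.neg.upperSemicontinuous)
    (fun x hx => by
      have h1 := hR x ((le_max_left _ _).trans_lt hx)
      have h2 := (div_lt_iff₀ (by linarith)).1 ((le_max_right _ _).trans_lt hx)
      have h3 := hleφ x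
      have h4 : K * (‖x‖ - ‖y‖) ≤ K * ‖x - y‖ :=
        mul_le_mul_of_nonneg_left (norm_sub_norm_le x y) (by linarith)
      linarith)
  have hgrad := hu.2 m φ hφ (Eventually.of_forall hm)
  have hgrad1 : ‖gradient φ m‖ ≤ 1 := by linarith [(le_max_right _ _).trans hgrad]
  have hmy := norm_sub_le_of_norm_gradient_cone_le hK hδ hgrad1
  have hmρ : m ∈ Metric.ball y ρ := by
    rw [mem_ball_iff_norm]
    exact lt_of_pow_lt_pow_left₀ 2 hρ.le
      (lt_of_mul_lt_mul_left (hmy.trans_lt hδρ) hK2.le)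
  have h1 := hball m hmρ
  have h2 := hm x
  have h3 : 0 ≤ φ m := by positivity
  have h4 := hφle x
  have h5 : K * (‖x - y‖ + δ) ≤ K * (‖x - y‖ + η) := by gcongr
  linarith

/-! ### Comparison of subsolutions and supersolutions -/

lemma IsViscositySubsolution.viscosityLaplacianGE {n : ℕ} {f : EuclideanSpace ℝ (Fin n) → ℝ}
    {lam : ℝ} {u : EuclideanSpace ℝ (Fin n) → ℝ} (hu : IsViscositySubsolution f lam u)
    {s : Set (EuclideanSpace ℝ (Fin n))} {c : ℝ} (hc : ∀ x ∈ s, c ≤ lam - f x) :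
    ViscosityLaplacianGE u s c := by
  intro x hx ψ hψ hmax
  linarith [(le_max_left _ _).trans (hu.2 x ψ hψ hmax), hc x hx]

/-- The estimate obtained by testing the supersolution `v` with `τ U`, where `U` is a mollification
of the subsolution `u` and `τ < 1`: the gradient of `τ U` has norm at most `τ`, so at a minimum
point of `v - τ U` the second-order part of the equation for `v` must be active. -/
lemma sub_mul_ge_of_subsolution_of_supersolution {n : ℕ} (hn : 0 < n)
    {f : EuclideanSpace ℝ (Fin n) → ℝ} (hf : Continuous f) {M : ℝ} (hM : ∀ x, M ≤ f x)
    {lam mu : ℝ} {u v : EuclideanSpace ℝ (Fin n) → ℝ} (hu : IsViscositySubsolution f lam u)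
    (hugrowth : limsupGrowth u ≤ 1) (hv : IsViscositySupersolution f mu v)
    (hvgrowth : 1 ≤ liminfGrowth v) {τ η : ℝ} (hτ : 0 < τ) (hτ1 : τ < 1) (hη : 0 < η) :
    (1 - τ) * M - τ * η ≤ mu - τ * lam := by
  have hlip := hu.lipschitzWith hugrowth
  obtain ⟨R₁, hR₁⟩ := exists_radius_mul_norm_le hvgrowth (κ := (1 + τ) / 2) (by linarith)
  -- All minimum points of `v - τ U` lie in the ball of radius `R`, whatever the mollification.
  set R := max R₁ ((v 0 + 2 * τ) / ((1 - τ) / 2))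
  obtain ⟨δ, hδ, hfδ⟩ := Metric.uniformContinuousOn_iff.1
    ((isCompact_closedBall (0 : EuclideanSpace ℝ (Fin n)) (R + 1)).uniformContinuousOn_of_continuous
      hf.continuousOn) η hη
  have hε : 0 < min 1 δ := lt_min one_pos hδ
  set φ : ContDiffBump (0 : EuclideanSpace ℝ (Fin n)) :=
    ⟨min 1 δ / 4, min 1 δ / 2, by linarith, by linarith⟩
  set U := mollify φ u
  have hU : ContDiff ℝ 2 U := contDiff_mollify φ hlip.continuous
  have hUu (x) : |U x - u x| ≤ 1 := by
    refine dist_mollify_le φ hlip.continuous fun y hy => (hlip.dist_le_mul y x).trans ?_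
    have h1 : dist y x < min 1 δ / 2 := hy
    have := min_le_left 1 δ
    rw [NNReal.coe_one]
    linarith
  obtain ⟨m, hmR, hm⟩ := exists_forall_le_of_upperSemicontinuous
    (g := fun x => τ * U x - v x) (x₀ := 0) (R := R)
    (by
      simp only [sub_eq_add_neg]
      exact (continuous_const.mul hU.continuous).upperSemicontinuous.add
        fun x c hc => (hv.1 x (-c) (show -c < v x from neg_lt.1 hc)).mono fun y hy => neg_lt.1 hy)
    (fun x hx => by
      have h1 := hR₁ x ((le_max_left _ _).trans_lt hx)
      have h2 := (div_lt_iff₀ (by linarith)).1 ((le_max_right _ _).trans_lt hx)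
      have h3 := hlip.le_add_mul x 0
      rw [NNReal.coe_one, one_mul, dist_zero_right] at h3
      have h4 := abs_le.1 (hUu x)
      have h5 := abs_le.1 (hUu 0)
      have h6 : τ * (U x - U 0) ≤ τ * (‖x‖ + 2) :=
        mul_le_mul_of_nonneg_left (by linarith) hτ.le
      linarith)
  have htest := hv.2 m (τ • U) (hU.const_smul τ) (Eventually.of_forall fun x => by
    have := hm x
    simp only [Pi.smul_apply, smul_eq_mul]
    linarith)
  have hgrad : ‖gradient (τ • U) m‖ - 1 < 0 := by
    rw [norm_gradient_eq, fderiv_const_smul_field, Pi.smul_apply, norm_smul,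
      Real.norm_of_nonneg hτ.le]
    have h1 := norm_fderiv_le_of_lipschitz ℝ (lipschitzWith_mollify φ hlip) (x₀ := m)
    rw [NNReal.coe_one] at h1
    nlinarith
  have hΔv := (le_max_iff.1 htest).resolve_right hgrad.not_ge
  rw [InnerProductSpace.laplacian_smul τ hU.contDiffAt, smul_eq_mul] at hΔv
  have hΔu : lam - f m - η ≤ Laplacian.laplacian U m := by
    refine le_laplacian_mollify hn φ hlip.continuous (R := min 1 δ) (by change _ / 2 < _; linarith)
      (hu.viscosityLaplacianGE fun x hx => ?_)
    have hxm : dist x m < min 1 δ := hx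
    have h1 := abs_lt.1 (hfδ x (by
      rw [mem_closedBall_zero_iff]
      have h2 := norm_le_norm_add_norm_sub' x m
      rw [← dist_eq_norm] at h2
      linarith [min_le_left 1 δ]) m (by
      rw [mem_closedBall_zero_iff]
      linarith) (hxm.trans_le (min_le_right _ _)))
    linarith
  have h1 := mul_le_mul_of_nonneg_left hΔu hτ.le
  have h2 := mul_le_mul_of_nonneg_left (hM m) (sub_pos.2 hτ1).le
  linarith

/-- The comparison principle between eigenvalues of subsolutions and of supersolutions. -/
lemma le_of_subsolution_of_supersolution {n : ℕ} (hn : 0 < n)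
    {f : EuclideanSpace ℝ (Fin n) → ℝ} (hf : Continuous f) {M : ℝ} (hM : ∀ x, M ≤ f x)
    {lam mu : ℝ} {u v : EuclideanSpace ℝ (Fin n) → ℝ} (hu : IsViscositySubsolution f lam u)
    (hugrowth : limsupGrowth u ≤ 1) (hv : IsViscositySupersolution f mu v)
    (hvgrowth : 1 ≤ liminfGrowth v) : lam ≤ mu := by
  have ht : Tendsto (fun t : ℝ => mu - (1 - t) * lam - (t * M - (1 - t) * t)) (𝓝[>] 0)
      (𝓝 (mu - lam)) := by
    have : Tendsto (fun t : ℝ => mu - (1 - t) * lam - (t * M - (1 - t) * t)) (𝓝 0)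
        (𝓝 (mu - (1 - 0) * lam - (0 * M - (1 - 0) * 0))) := Continuous.tendsto (by fun_prop) 0
    simpa using this.mono_left nhdsWithin_le_nhds
  refine sub_nonneg.1 (ge_of_tendsto ht ?_)
  filter_upwards [Ioo_mem_nhdsGT (zero_lt_one' ℝ)] with t ht
  have := sub_mul_ge_of_subsolution_of_supersolution hn hf hM hu hugrowth hv hvgrowth
    (τ := 1 - t) (η := t) (by linarith [ht.2]) (by linarith [ht.1]) ht.1
  rw [sub_sub_cancel] at this
  linarith

lemma exists_forall_le_of_tendsto_div_norm {n : ℕ} {f : EuclideanSpace ℝ (Fin n) → ℝ}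
    (hf : Continuous f)
    (h : Tendsto (fun x => f x / ‖x‖) (Bornology.cobounded (EuclideanSpace ℝ (Fin n))) atTop) :
    ∃ M, ∀ x, M ≤ f x := by
  obtain ⟨R, hR⟩ := exists_radius_of_eventually_cobounded (h.eventually_ge_atTop 0)
  obtain ⟨M, hM⟩ := (isCompact_closedBall (0 : EuclideanSpace ℝ (Fin n)) (max R 0)).bddBelow_image
    hf.continuousOn
  refine ⟨min M 0, fun x => ?_⟩
  rcases le_or_gt ‖x‖ (max R 0) with hx | hx
  · exact (min_le_left _ _).trans (hM ⟨x, by simpa using hx, rfl⟩)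
  · refine (min_le_right _ _).trans ?_
    by_contra! hneg
    exact (div_neg_of_neg_of_pos hneg ((le_max_right _ _).trans_lt hx)).not_ge
      (hR x ((le_max_left _ _).trans_lt hx))

theorem corollary3p1 (n : ℕ) (f : EuclideanSpace ℝ (Fin n) → ℝ)
    (hf_smooth : ContDiff ℝ ∞ f)
    (hf_convex : ConvexOn ℝ Set.univ f)
    (hf_superlinear :
      Tendsto (fun x => f x / ‖x‖) (Bornology.cobounded (EuclideanSpace ℝ (Fin n))) atTop)
    (lamStar : ℝ)
    (h_eigenvalue : ∃ u : EuclideanSpace ℝ (Fin n) → ℝ, IsViscositySolution f lamStar u ∧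
      Tendsto (fun x => u x / ‖x‖) (Bornology.cobounded (EuclideanSpace ℝ (Fin n))) (𝓝 1)) :
    IsLUB {lam : ℝ | ∃ u : EuclideanSpace ℝ (Fin n) → ℝ,
      IsViscositySubsolution f lam u ∧ limsupGrowth u ≤ 1} lamStar ∧
    IsGLB {mu : ℝ | ∃ v : EuclideanSpace ℝ (Fin n) → ℝ,
      IsViscositySupersolution f mu v ∧ 1 ≤ liminfGrowth v} lamStar := by
  obtain ⟨u, ⟨-, hsub, hsup⟩, hu⟩ := h_eigenvalue
  have hu' : Tendsto (fun x => ((u x / ‖x‖ : ℝ) : EReal))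
      (Bornology.cobounded (EuclideanSpace ℝ (Fin n))) (𝓝 1) :=
    (continuous_coe_real_ereal.tendsto 1).comp hu
  have hle : limsupGrowth u ≤ 1 := by
    rcases (Bornology.cobounded (EuclideanSpace ℝ (Fin n))).eq_or_neBot with h | h
    · simp [limsupGrowth, h]
    · exact hu'.limsup_eq.le
  have hge : 1 ≤ liminfGrowth u := by
    rcases (Bornology.cobounded (EuclideanSpace ℝ (Fin n))).eq_or_neBot with h | h
    · simp [liminfGrowth, h]
    · exact hu'.liminf_eq.ge
  have hcomp {lam mu : ℝ} {u v : EuclideanSpace ℝ (Fin n) → ℝ}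
      (hu : IsViscositySubsolution f lam u) (hugrowth : limsupGrowth u ≤ 1)
      (hv : IsViscositySupersolution f mu v) (hvgrowth : 1 ≤ liminfGrowth v) : lam ≤ mu := by
    rcases n.eq_zero_or_pos with rfl | hn
    · -- In dimension zero there are no derivatives: `lam ≤ f 0 ≤ mu`.
      have h1 := hu.2 0 0 contDiff_const (Eventually.of_forall fun x => by
        rw [Subsingleton.elim x 0])
      have h2 := hv.2 0 0 contDiff_const (Eventually.of_forall fun x => by
        rw [Subsingleton.elim x 0])
      have h3 : ‖gradient (0 : EuclideanSpace ℝ (Fin 0) → ℝ) 0‖ - 1 < 0 := by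
        rw [Subsingleton.elim (gradient _ _) 0]; simp
      have h4 := (le_max_iff.1 h2).resolve_right h3.not_ge
      linarith [(le_max_left _ _).trans h1]
    · obtain ⟨M, hM⟩ := exists_forall_le_of_tendsto_div_norm hf_smooth.continuous hf_superlinear
      exact le_of_subsolution_of_supersolution hn hf_smooth.continuous hM hu hugrowth hv hvgrowth
  exact ⟨⟨fun lam ⟨w, hw, hwg⟩ => hcomp hw hwg hsup hge, fun b hb => hb ⟨u, hsub, hle⟩⟩,
    ⟨fun mu ⟨w, hw, hwg⟩ => hcomp hsub hle hw hwg, fun b hb => hb ⟨u, hsup, hge⟩⟩⟩
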